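/- Consider a two-armed stochastic bandit: let $R_{\max}>0$, let $\mu$ be a finite measure on $[-R_{\max},R_{\max}]$, and for $a\in\{1,2\}$ let the reward of arm $a$ have probability density $P_a\ge 0$ with respect to $\mu$ and mean $r(a)=\int_{-R_{\max}}^{R_{\max}} x\,P_a(x)\,\mu(dx)$. Assume $r(1)>r(2)$. For $\theta\in\mathbb{R}^2$ let $\pi_\theta(a)=e^{\theta(a)}/(e^{\theta(1)}+e^{\theta(2)})$. The gradient bandit algorithm with constant learning rate $\eta>0$ starts from (possibly random) initial parameters $\theta_1\in\mathbb{R}^2$ and, at each time $t\ge 1$, conditionally on the past $(\theta_1,a_1,R_1,\dots,a_{t-1},R_{t-1})$, samples an action $a_t\sim\pi_{\theta_t}$ and then a reward $R_t$ with density $P_{a_t}$ with respect to $\mu$, and sets \[ \theta_{t+1}(a)=\begin{cases}\theta_t(a)+\eta\,(1-\pi_{\theta_t}(a))\,R_t & \text{if } a=a_t,\\ \theta_t(a)-\eta\,\pi_{\theta_t}(a)\,R_t & \text{if } a\ne a_t.\end{cases} \] Then, for every constant $\eta>0$, almost surely, as $t\to\infty$, \[ \pi_{\theta_t}(1)\to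 1,\qquad \theta_t(1)\to+\infty,\qquad \theta_t(2)\to-\infty . \] -/

import Mathlib

open MeasureTheory Filter Topology

/-- A `K`-armed stochastic bandit whose rewards lie in `[-Rmax, Rmax]`: the reward of arm `a` has
probability density `density a` with respect to a common finite measure `base` that is
carried by `[-Rmax, Rmax]`. -/
structure StochasticBandit (K : ℕ) where
  Rmax : ℝ
  Rmax_pos : 0 < Rmax
  base : Measure ℝ
  base_finite : IsFiniteMeasure base
  base_support : base (Set.Icc (-Rmax) Rmax)ᶜ = 0
  density : Fin K → ℝ → ℝ
  density_measurable : ∀ a, Measurable (density a)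
  density_nonneg : ∀ a x, 0 ≤ density a x
  density_lintegral : ∀ a, ∫⁻ x, ENNReal.ofReal (density a x) ∂base = 1

namespace StochasticBandit

/-- The reward distribution of arm `a`. -/
noncomputable def rewardLaw {K : ℕ} (B : StochasticBandit K) (a : Fin K) : Measure ℝ :=
  B.base.withDensity fun x => ENNReal.ofReal (B.density a x)

/-- The true mean reward of arm `a`. -/
noncomputable def meanReward {K : ℕ} (B : StochasticBandit K) (a : Fin K) : ℝ :=
  ∫ x in Set.Icc (-B.Rmax) B.Rmax, x * B.density a x ∂B.base

end StochasticBandit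

/-- The softmax policy with parameter vector `θ`. -/
noncomputable def softmaxPolicy {K : ℕ} (θ : Fin K → ℝ) (a : Fin K) : ℝ :=
  Real.exp (θ a) / ∑ b, Real.exp (θ b)

/-- The parameter vectors produced by the gradient bandit algorithm (without baselines) with
learning rate `η` and initial parameters `θ₁`, along the sequence of sampled actions `act` and
observed rewards `rew`. Time is counted from `0`: `gradientBanditParam η θ₁ act rew t` is the
parameter vector from which the action `act t` is drawn. -/
noncomputable def gradientBanditParam {K : ℕ} (η : ℝ) (θ₁ : Fin K → ℝ) (act : ℕ → Fin K)
    (rew : ℕ → ℝ) : ℕ → Fin K → ℝ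
  | 0 => θ₁
  | t + 1 => fun a =>
      let θ := gradientBanditParam η θ₁ act rew t
      if act t = a then θ a + η * (1 - softmaxPolicy θ a) * rew t
      else θ a - η * softmaxPolicy θ a * rew t

/-- The information available before the action at time `t` is drawn: the initial parameters
(which may be random) and all actions and observed rewards at times `s < t`. -/
@[reducible]
def banditHistory {Ω : Type*} {K : ℕ} (θ₁ : Ω → Fin K → ℝ) (act : ℕ → Ω → Fin K)
    (rew : ℕ → Ω → ℝ) (t : ℕ) : MeasurableSpace Ω :=
  MeasurableSpace.comap θ₁ inferInstance ⊔
    ⨆ s : Fin t, MeasurableSpace.comap (fun ω => (act s ω, rew s ω)) inferInstance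

/-- `(act, rew)` is the random sequence of actions and observed rewards of the gradient bandit
algorithm on the bandit `B` with learning rate `η` and initial parameters `θ₁`: conditionally on
the past, the action at time `t` is drawn from the current softmax policy and, given that it is
`a`, the observed reward is drawn from the reward distribution of `a`. -/
structure IsGradientBanditRun {Ω : Type*} [MeasurableSpace Ω] {K : ℕ} (P : Measure Ω)
    (B : StochasticBandit K) (η : ℝ) (θ₁ : Ω → Fin K → ℝ) (act : ℕ → Ω → Fin K)
    (rew : ℕ → Ω → ℝ) : Prop where
  measurable_init : Measurable θ₁
  measurable_act : ∀ t, Measurable (act t)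
  measurable_rew : ∀ t, Measurable (rew t)
  cond_law : ∀ (t : ℕ) (a : Fin K) (S : Set ℝ), MeasurableSet S →
    P[({ω | act t ω = a ∧ rew t ω ∈ S}.indicator fun _ => (1 : ℝ)) | banditHistory θ₁ act rew t]
      =ᵐ[P] fun ω =>
        softmaxPolicy (gradientBanditParam η (θ₁ ω) (act · ω) (rew · ω) t) a *
          (B.rewardLaw a).real S

/-! With two arms everything is governed by the gap x = θ(0) - θ(1), as the sum of the parameters is
conserved and p = π(0) = sigmoid(x). The exponential Y = exp(-λ(x_t - x_0)), with λ = κ/(2η), is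
multiplied at each step by exp(cR), where c = -κ(1-p) on arm 0 and c = κp on arm 1.

The conditional mean of cR is -κδp(1-p), δ being the gap of the means, and that of c²R² is at most
κ²Rmax²p(1-p). The noise thus carries the same factor p(1-p) as the drift, and a small κ, chosen
without regard to η, lets the drift win: this is why every constant learning rate works. Hence Y is
a nonnegative supermartingale with decrement at least D = (κδ/2)p(1-p)Y. It converges and D → 0
(`ae_tendsto_of_condExp_succ_le_sub`). A positive limit of Y would make x converge, keep p away from
0 and 1, and contradict D → 0. So Y → 0 and x → +∞. -/

/-- If a nonnegative adapted process `Y` loses at least `D t ≥ 0` in conditional mean at each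
step `t`, then almost surely `Y` converges and `D t` tends to zero. -/
theorem ae_tendsto_of_condExp_succ_le_sub {Ω : Type*} {m : MeasurableSpace Ω} {P : Measure Ω}
    [IsFiniteMeasure P] {ℱ : Filtration ℕ m} {Y D : ℕ → Ω → ℝ} (hY : StronglyAdapted ℱ Y)
    (hYint : ∀ t, Integrable (Y t) P) (hY0 : ∀ t ω, 0 ≤ Y t ω)
    (hDint : ∀ t, Integrable (D t) P) (hD0 : ∀ t ω, 0 ≤ D t ω)
    (hstep : ∀ t, P[Y (t + 1) | ℱ t] ≤ᵐ[P] fun ω => Y t ω - D t ω) :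
    ∀ᵐ ω ∂P, (∃ c, Tendsto (fun t => Y t ω) atTop (𝓝 c)) ∧
      Tendsto (fun t => D t ω) atTop (𝓝 0) := by
  have hsuper : Supermartingale Y ℱ P := supermartingale_nat hY hYint fun t =>
    (hstep t).mono fun ω h => h.trans (sub_le_self _ (hD0 t ω))
  have hmean : ∀ t, ∫ ω, Y (t + 1) ω ∂P ≤ ∫ ω, Y t ω ∂P - ∫ ω, D t ω ∂P := fun t => by
    rw [← integral_condExp (ℱ.le t), ← integral_sub (hYint t) (hDint t)]
    exact integral_mono_ae integrable_condExp ((hYint t).sub (hDint t)) (hstep t)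
  have hsum : ∀ n, ∫ ω, Y n ω ∂P + ∑ t ∈ Finset.range n, ∫ ω, D t ω ∂P ≤ ∫ ω, Y 0 ω ∂P := by
    intro n
    induction n with
    | zero => simp
    | succ n ih => rw [Finset.sum_range_succ]; linarith [hmean n]
  have hDpos : ∀ t, 0 ≤ ∫ ω, D t ω ∂P := fun t => integral_nonneg (hD0 t)
  have hYpos : ∀ t, 0 ≤ ∫ ω, Y t ω ∂P := fun t => integral_nonneg (hY0 t)
  have hbdd : ∀ n, eLpNorm ((-Y) n) 1 P ≤ ((∫ ω, Y 0 ω ∂P).toNNReal : ENNReal) := by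
    intro n
    rw [Pi.neg_apply, eLpNorm_neg, eLpNorm_one_eq_lintegral_enorm,
      ← ofReal_integral_norm_eq_lintegral_enorm (hYint n)]
    refine ENNReal.ofReal_le_ofReal ?_
    simp only [Real.norm_of_nonneg (hY0 n _)]
    linarith [hsum n, Finset.sum_nonneg fun t (_ : t ∈ Finset.range n) => hDpos t]
  -- The decrements telescope, so their total expectation is at most that of `Y 0`; hence their sum
  -- is almost surely finite.
  have hfin : ∫⁻ ω, ∑' t, ENNReal.ofReal (D t ω) ∂P ≠ ⊤ := by
    rw [lintegral_tsum fun t => (hDint t).aemeasurable.ennreal_ofReal]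
    simp only [← ofReal_integral_eq_lintegral_ofReal (hDint _) (ae_of_all _ (hD0 _))]
    refine (Summable.tsum_ofReal_lt_top ?_).ne
    exact summable_of_sum_range_le hDpos fun n => by linarith [hsum n, hYpos n]
  filter_upwards [hsuper.neg.exists_ae_tendsto_of_bdd hbdd, ae_lt_top' (by
    exact AEMeasurable.tsum fun t => (hDint t).aemeasurable.ennreal_ofReal) hfin]
    with ω ⟨c, hc⟩ hω
  refine ⟨⟨-c, by simpa using hc.neg⟩, ?_⟩
  have := (ENNReal.tendsto_toReal ENNReal.zero_ne_top).comp
    (ENNReal.tendsto_atTop_zero_of_tsum_ne_top hω.ne)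
  simpa [Function.comp_def, hD0] using this

/-! ### Reward laws -/

namespace StochasticBandit

variable {K : ℕ} (B : StochasticBandit K) (a : Fin K)

instance isProbabilityMeasure_rewardLaw : IsProbabilityMeasure (B.rewardLaw a) :=
  ⟨by rw [rewardLaw, withDensity_apply _ MeasurableSet.univ, Measure.restrict_univ,
    B.density_lintegral]⟩

theorem rewardLaw_compl_Icc : B.rewardLaw a (Set.Icc (-B.Rmax) B.Rmax)ᶜ = 0 :=
  withDensity_absolutelyContinuous _ _ B.base_support

theorem integrable_id_rewardLaw : Integrable (fun x : ℝ => x) (B.rewardLaw a) := by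
  refine Integrable.of_bound (C := B.Rmax) measurable_id.aestronglyMeasurable ?_
  have h : ∀ᵐ x ∂B.rewardLaw a, x ∈ Set.Icc (-B.Rmax) B.Rmax := B.rewardLaw_compl_Icc a
  filter_upwards [h] with x hx
  exact abs_le.2 hx

theorem integral_id_rewardLaw : ∫ x, x ∂B.rewardLaw a = B.meanReward a := by
  have h : B.base.restrict (Set.Icc (-B.Rmax) B.Rmax) = B.base :=
    Measure.restrict_eq_self_of_ae_mem B.base_support
  rw [meanReward, h, rewardLaw, integral_withDensity_eq_integral_toReal_smul
    (B.density_measurable a).ennreal_ofReal (ae_of_all _ fun _ => ENNReal.ofReal_lt_top)]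
  refine integral_congr_ae (ae_of_all _ fun x => ?_)
  simp [ENNReal.toReal_ofReal (B.density_nonneg a x), mul_comm]

end StochasticBandit

/-! ### Softmax and the deterministic recursion -/

theorem measurable_softmaxPolicy {K : ℕ} (a : Fin K) :
    Measurable fun θ : Fin K → ℝ => softmaxPolicy θ a := by
  unfold softmaxPolicy
  fun_prop

theorem softmaxPolicy_nonneg {K : ℕ} (θ : Fin K → ℝ) (a : Fin K) : 0 ≤ softmaxPolicy θ a := by
  unfold softmaxPolicy
  positivity

theorem softmaxPolicy_le_one {K : ℕ} (θ : Fin K → ℝ) (a : Fin K) : softmaxPolicy θ a ≤ 1 :=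
  div_le_one_of_le₀ (Finset.single_le_sum (f := fun b => Real.exp (θ b))
    (fun _ _ => (Real.exp_pos _).le) (Finset.mem_univ a)) (by positivity)

theorem softmaxPolicy_zero_eq_sigmoid (θ : Fin 2 → ℝ) :
    softmaxPolicy θ 0 = Real.sigmoid (θ 0 - θ 1) := by
  rw [softmaxPolicy, Fin.sum_univ_two, Real.sigmoid_def, neg_sub, Real.exp_sub]
  field_simp

theorem softmaxPolicy_one_eq (θ : Fin 2 → ℝ) : softmaxPolicy θ 1 = 1 - softmaxPolicy θ 0 := by
  rw [softmaxPolicy, softmaxPolicy, Fin.sum_univ_two]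
  field_simp
  ring

section Trajectory

variable (η : ℝ) (θ₁ : Fin 2 → ℝ) (act : ℕ → Fin 2) (rew : ℕ → ℝ)

/-- With two arms the parameters of the gradient bandit have a constant sum. -/
theorem gradientBanditParam_zero_add_one (t : ℕ) :
    gradientBanditParam η θ₁ act rew t 0 + gradientBanditParam η θ₁ act rew t 1
      = θ₁ 0 + θ₁ 1 := by
  induction t with
  | zero => rfl
  | succ t ih =>
    rw [← ih]
    have h : act t = 0 ∨ act t = 1 := by omega
    rcases h with h | h <;> simp [gradientBanditParam, h, softmaxPolicy_one_eq]

/-- The recursion for the gap between the two parameters. -/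
theorem gradientBanditParam_succ_zero_sub_one (t : ℕ) :
    gradientBanditParam η θ₁ act rew (t + 1) 0 - gradientBanditParam η θ₁ act rew (t + 1) 1
      = gradientBanditParam η θ₁ act rew t 0 - gradientBanditParam η θ₁ act rew t 1
        + 2 * η * ((if act t = 0 then 1 - softmaxPolicy (gradientBanditParam η θ₁ act rew t) 0
          else -softmaxPolicy (gradientBanditParam η θ₁ act rew t) 0) * rew t) := by
  have h : act t = 0 ∨ act t = 1 := by omega
  rcases h with h | h <;> simp [gradientBanditParam, h, softmaxPolicy_one_eq] <;> ring

end Trajectory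

/-! ### Measurability with respect to the past -/

section History

variable {Ω : Type*} {K : ℕ} (θ₁ : Ω → Fin K → ℝ) (act : ℕ → Ω → Fin K) (rew : ℕ → Ω → ℝ)

theorem banditHistory_mono : Monotone (banditHistory θ₁ act rew) := by
  intro s t hst
  refine sup_le_sup_left (iSup_le fun i => ?_) _
  exact le_iSup (fun j : Fin t => MeasurableSpace.comap (fun ω => (act j ω, rew j ω)) inferInstance)
    (Fin.castLE hst i)

theorem measurable_init_banditHistory (t : ℕ) : Measurable[banditHistory θ₁ act rew t] θ₁ :=
  measurable_iff_comap_le.2 le_sup_left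

theorem measurable_act_rew_banditHistory {s t : ℕ} (hst : s < t) :
    Measurable[banditHistory θ₁ act rew t] fun ω => (act s ω, rew s ω) :=
  measurable_iff_comap_le.2 (le_sup_of_le_right (le_iSup_of_le ⟨s, hst⟩ le_rfl))

theorem measurable_gradientBanditParam (η : ℝ) (t : ℕ) :
    Measurable[banditHistory θ₁ act rew t]
      fun ω => gradientBanditParam η (θ₁ ω) (act · ω) (rew · ω) t := by
  induction t with
  | zero => exact measurable_init_banditHistory θ₁ act rew 0
  | succ t ih =>
    let _ : MeasurableSpace Ω := banditHistory θ₁ act rew (t + 1)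
    have ih' : Measurable fun ω => gradientBanditParam η (θ₁ ω) (act · ω) (rew · ω) t :=
      ih.mono (banditHistory_mono θ₁ act rew t.le_succ) le_rfl
    have hpair : Measurable fun ω => (act t ω, rew t ω) :=
      measurable_act_rew_banditHistory θ₁ act rew t.lt_succ_self
    have hact : Measurable (act t) := hpair.fst
    have hrew : Measurable (rew t) := hpair.snd
    refine measurable_pi_lambda _ fun a => ?_
    have hθ := (measurable_pi_apply a).comp ih'
    have hπ := (measurable_softmaxPolicy a).comp ih'
    exact Measurable.ite (hact (measurableSet_singleton a))
      (hθ.add (((measurable_const.sub hπ).const_mul η).mul hrew))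
      (hθ.sub ((hπ.const_mul η).mul hrew))

end History

/-! ### Conditional laws of the rewards -/

namespace IsGradientBanditRun

variable {Ω : Type*} {m : MeasurableSpace Ω} {K : ℕ} {P : Measure Ω}
  {B : StochasticBandit K} {η : ℝ} {θ₁ : Ω → Fin K → ℝ} {act : ℕ → Ω → Fin K} {rew : ℕ → Ω → ℝ}

theorem banditHistory_le (hrun : IsGradientBanditRun P B η θ₁ act rew) (t : ℕ) :
    banditHistory θ₁ act rew t ≤ m :=
  sup_le hrun.measurable_init.comap_le (iSup_le fun s =>
    ((hrun.measurable_act s).prodMk (hrun.measurable_rew s)).comap_le)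

/-- The filtration of the information available to the algorithm. -/
def filtration (hrun : IsGradientBanditRun P B η θ₁ act rew) : Filtration ℕ m where
  seq := banditHistory θ₁ act rew
  mono' := banditHistory_mono θ₁ act rew
  le' := hrun.banditHistory_le

variable [IsProbabilityMeasure P]

theorem integrable_softmaxPolicy (hrun : IsGradientBanditRun P B η θ₁ act rew) (t : ℕ)
    (a : Fin K) : Integrable (fun ω => softmaxPolicy
      (gradientBanditParam η (θ₁ ω) (act · ω) (rew · ω) t) a) P := by
  refine Integrable.of_bound (C := 1) ((measurable_softmaxPolicy a).comp
    ((measurable_gradientBanditParam θ₁ act rew η t).mono (hrun.banditHistory_le t)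
      le_rfl)).aestronglyMeasurable (ae_of_all _ fun ω => ?_)
  rw [Real.norm_of_nonneg (softmaxPolicy_nonneg _ _)]
  exact softmaxPolicy_le_one _ _

/-- On a past event `A`, the reward of arm `a` is distributed according to `B.rewardLaw a`. -/
theorem map_rew_restrict (hrun : IsGradientBanditRun P B η θ₁ act rew) (t : ℕ) (a : Fin K)
    {A : Set Ω} (hA : MeasurableSet[banditHistory θ₁ act rew t] A) :
    (P.restrict ({ω | act t ω = a} ∩ A)).map (rew t)
      = ENNReal.ofReal (∫ ω in A, softmaxPolicy
          (gradientBanditParam η (θ₁ ω) (act · ω) (rew · ω) t) a ∂P) • B.rewardLaw a := by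
  have hact : MeasurableSet {ω | act t ω = a} := hrun.measurable_act t (measurableSet_singleton a)
  have hle := hrun.banditHistory_le t
  ext S hS
  have hE : MeasurableSet {ω | act t ω = a ∧ rew t ω ∈ S} := hact.inter (hrun.measurable_rew t hS)
  -- Integrating `cond_law` over `A` gives the probability that `A` occurs, arm `a` is drawn and the
  -- reward lies in `S`.
  have hint := setIntegral_condExp hle
    ((integrable_const (1 : ℝ)).indicator hE : Integrable _ P) hA
  rw [setIntegral_congr_ae (hle A hA) ((hrun.cond_law t a S hS).mono fun ω h _ => h),
    integral_mul_const, integral_indicator_const _ hE, measureReal_restrict_apply hE,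
    smul_eq_mul, mul_one] at hint
  rw [Measure.map_apply (hrun.measurable_rew t) hS,
    Measure.restrict_apply (hrun.measurable_rew t hS), Measure.smul_apply, smul_eq_mul,
    ← ofReal_measureReal (μ := B.rewardLaw a), ← ENNReal.ofReal_mul
      (integral_nonneg fun ω => softmaxPolicy_nonneg _ _), hint, ofReal_measureReal]
  congr 1
  ext ω
  simp only [Set.mem_inter_iff, Set.mem_preimage, Set.mem_ofPred_eq]
  tauto

theorem integrable_indicator_rew (hrun : IsGradientBanditRun P B η θ₁ act rew) (t : ℕ)
    (a : Fin K) {f : ℝ → ℝ} (hf : Integrable f (B.rewardLaw a)) :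
    Integrable ({ω | act t ω = a}.indicator fun ω => f (rew t ω)) P := by
  have hact : MeasurableSet {ω | act t ω = a} := hrun.measurable_act t (measurableSet_singleton a)
  have hmap := hrun.map_rew_restrict t a MeasurableSet.univ
  rw [Set.inter_univ] at hmap
  rw [integrable_indicator_iff hact, IntegrableOn]
  refine Integrable.comp_measurable (g := f) ?_ (hrun.measurable_rew t)
  rw [hmap]
  exact hf.smul_measure ENNReal.ofReal_ne_top

/-- The conditional expectation of a function of the reward, on the event that arm `a` is drawn. -/
theorem condExp_indicator_rew (hrun : IsGradientBanditRun P B η θ₁ act rew) (t : ℕ)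
    (a : Fin K) {f : ℝ → ℝ} (hf : Integrable f (B.rewardLaw a)) :
    P[{ω | act t ω = a}.indicator (fun ω => f (rew t ω)) | banditHistory θ₁ act rew t]
      =ᵐ[P] fun ω => softmaxPolicy (gradientBanditParam η (θ₁ ω) (act · ω) (rew · ω) t) a *
        ∫ x, f x ∂B.rewardLaw a := by
  have hact : MeasurableSet {ω | act t ω = a} := hrun.measurable_act t (measurableSet_singleton a)
  have hle := hrun.banditHistory_le t
  refine (ae_eq_condExp_of_forall_setIntegral_eq hle (hrun.integrable_indicator_rew t a hf)
    (fun A _ _ => ((hrun.integrable_softmaxPolicy t a).mul_const _).integrableOn)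
    (fun A hA _ => ?_) ?_).symm
  · have hmap := hrun.map_rew_restrict t a hA
    rw [integral_mul_const, setIntegral_indicator hact, Set.inter_comm A,
      ← integral_map (hrun.measurable_rew t).aemeasurable (f := f), hmap, integral_smul_measure,
      ENNReal.toReal_ofReal (integral_nonneg fun ω => softmaxPolicy_nonneg _ _), smul_eq_mul]
    rw [hmap]
    exact (hf.smul_measure ENNReal.ofReal_ne_top).aestronglyMeasurable
  · exact (((measurable_softmaxPolicy a).comp
      (measurable_gradientBanditParam θ₁ act rew η t)).mul_const _).aestronglyMeasurable

theorem ae_abs_rew_le (hrun : IsGradientBanditRun P B η θ₁ act rew) :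
    ∀ᵐ ω ∂P, ∀ t, |rew t ω| ≤ B.Rmax := by
  refine ae_all_iff.2 fun t => ?_
  have h : ∀ a, ∀ᵐ ω ∂P, act t ω = a → rew t ω ∈ Set.Icc (-B.Rmax) B.Rmax := fun a => by
    have hact : MeasurableSet {ω | act t ω = a} :=
      hrun.measurable_act t (measurableSet_singleton a)
    have hmap := hrun.map_rew_restrict t a MeasurableSet.univ
    rw [Set.inter_univ] at hmap
    refine (ae_restrict_iff' hact).1 (ae_of_ae_map (hrun.measurable_rew t).aemeasurable
      (p := fun x => x ∈ Set.Icc (-B.Rmax) B.Rmax) ?_)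
    rw [hmap]
    exact Measure.ae_smul_measure (B.rewardLaw_compl_Icc a) _
  filter_upwards [ae_all_iff.2 h] with ω hω
  exact abs_le.2 (hω _ rfl)

end IsGradientBanditRun

/-! ### Supermartingale argument for the gap -/

namespace IsGradientBanditRun

variable {Ω : Type*} {m : MeasurableSpace Ω} {P : Measure Ω} [IsProbabilityMeasure P]

/-- The conditional expectation of a past-measurable weight times a function of the reward. -/
theorem condExp_mul_indicator_rew {K : ℕ} {B : StochasticBandit K} {η : ℝ}
    {θ₁ : Ω → Fin K → ℝ} {act : ℕ → Ω → Fin K} {rew : ℕ → Ω → ℝ}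
    (hrun : IsGradientBanditRun P B η θ₁ act rew) (t : ℕ) (a : Fin K) {f : ℝ → ℝ}
    (hf : Integrable f (B.rewardLaw a)) {W : Ω → ℝ} (hW : Measurable[banditHistory θ₁ act rew t] W)
    {C : ℝ} (hC : ∀ᵐ ω ∂P, |W ω| ≤ C) :
    Integrable (W * {ω | act t ω = a}.indicator fun ω => f (rew t ω)) P ∧
    P[W * {ω | act t ω = a}.indicator (fun ω => f (rew t ω)) | banditHistory θ₁ act rew t]
      =ᵐ[P] fun ω => W ω * (softmaxPolicy (gradientBanditParam η (θ₁ ω) (act · ω) (rew · ω) t) a *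
        ∫ x, f x ∂B.rewardLaw a) := by
  have hg := hrun.integrable_indicator_rew t a hf
  have hint : Integrable (W * {ω | act t ω = a}.indicator fun ω => f (rew t ω)) P :=
    hg.bdd_mul (hW.mono (hrun.banditHistory_le t) le_rfl).aestronglyMeasurable hC
  refine ⟨hint, ?_⟩
  filter_upwards [condExp_mul_of_stronglyMeasurable_left hW.stronglyMeasurable hint hg,
    hrun.condExp_indicator_rew t a hf] with ω h₁ h₂
  rw [h₁, Pi.mul_apply, h₂]

variable {B : StochasticBandit 2} {η : ℝ} {θ₁ : Ω → Fin 2 → ℝ} {act : ℕ → Ω → Fin 2}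
  {rew : ℕ → Ω → ℝ}

/-- A function bounded, on the event that arm `a` is drawn, by a past-measurable affine function
of the reward has conditional expectation at most the policy average of the means. -/
theorem condExp_le_of_le_affine_rew (hrun : IsGradientBanditRun P B η θ₁ act rew) (t : ℕ)
    {Z : Ω → ℝ} (hZ : Integrable Z P) {V W : Fin 2 → Ω → ℝ}
    (hV : ∀ a, Measurable[banditHistory θ₁ act rew t] (V a))
    (hW : ∀ a, Measurable[banditHistory θ₁ act rew t] (W a)) {C : ℝ}
    (hVC : ∀ a, ∀ᵐ ω ∂P, |V a ω| ≤ C) (hWC : ∀ a, ∀ᵐ ω ∂P, |W a ω| ≤ C)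
    (hle : ∀ᵐ ω ∂P, Z ω ≤ V (act t ω) ω + W (act t ω) ω * rew t ω) :
    P[Z | banditHistory θ₁ act rew t] ≤ᵐ[P] fun ω =>
      ∑ a, softmaxPolicy (gradientBanditParam η (θ₁ ω) (act · ω) (rew · ω) t) a *
        (V a ω + W a ω * B.meanReward a) := by
  -- The constant 1 handles the intercept `V`, the identity the slope `W`.
  have hc : ∀ a, _ := fun a => hrun.condExp_mul_indicator_rew t a
    (integrable_const (1 : ℝ)) (hV a) (hVC a)
  have hl : ∀ a, _ := fun a => hrun.condExp_mul_indicator_rew t a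
    (B.integrable_id_rewardLaw a) (hW a) (hWC a)
  have hmono := condExp_mono (m := banditHistory θ₁ act rew t) hZ
    (((hc 0).1.add (hl 0).1).add ((hc 1).1.add (hl 1).1)) (by
      filter_upwards [hle] with ω h
      have ha : act t ω = 0 ∨ act t ω = 1 := by omega
      rcases ha with ha | ha <;> simpa [Set.indicator, ha] using h)
  filter_upwards [hmono, condExp_add ((hc 0).1.add (hl 0).1) ((hc 1).1.add (hl 1).1)
      (banditHistory θ₁ act rew t),
    condExp_add (hc 0).1 (hl 0).1 (banditHistory θ₁ act rew t),
    condExp_add (hc 1).1 (hl 1).1 (banditHistory θ₁ act rew t),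
    (hc 0).2, (hc 1).2, (hl 0).2, (hl 1).2] with ω h h₁ h₂ h₃ h₄ h₅ h₆ h₇
  refine h.trans (le_of_eq ?_)
  rw [h₁, Pi.add_apply, h₂, h₃, Pi.add_apply, Pi.add_apply, h₄, h₅, h₆, h₇, Fin.sum_univ_two]
  simp only [B.integral_id_rewardLaw, integral_const, probReal_univ, smul_eq_mul]
  ring

/-- Almost surely, the gap between the parameters of the better and the worse arm diverges. -/
theorem ae_tendsto_gap_atTop (hrun : IsGradientBanditRun P B η θ₁ act rew) (hη : 0 < η)
    (hB : B.meanReward 1 < B.meanReward 0) :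
    ∀ᵐ ω ∂P, Tendsto (fun t => gradientBanditParam η (θ₁ ω) (act · ω) (rew · ω) t 0 -
      gradientBanditParam η (θ₁ ω) (act · ω) (rew · ω) t 1) atTop atTop := by
  set x : ℕ → Ω → ℝ := fun t ω => gradientBanditParam η (θ₁ ω) (act · ω) (rew · ω) t 0 -
    gradientBanditParam η (θ₁ ω) (act · ω) (rew · ω) t 1 with hx
  set p : ℕ → Ω → ℝ := fun t ω => softmaxPolicy
    (gradientBanditParam η (θ₁ ω) (act · ω) (rew · ω) t) 0 with hp
  set δ := B.meanReward 0 - B.meanReward 1 with hδ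
  have hδ0 : 0 < δ := sub_pos.2 hB
  have hR := B.Rmax_pos
  -- The first bound keeps the exponent cR in [-1, 1]; the second makes the quadratic term cost at
  -- most half of the drift.
  obtain ⟨κ, hκ, hκ1, hκ2⟩ : ∃ κ : ℝ, 0 < κ ∧ κ * B.Rmax ≤ 1 ∧ κ * B.Rmax ^ 2 ≤ δ / 2 := by
    refine ⟨min (1 / B.Rmax) (δ / 2 / B.Rmax ^ 2), by positivity, ?_, ?_⟩
    · exact (le_div_iff₀ hR).1 (min_le_left _ _)
    · exact (le_div_iff₀ (by positivity)).1 (min_le_right _ _)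
  have hpx : ∀ t ω, p t ω = Real.sigmoid (x t ω) := fun t ω => softmaxPolicy_zero_eq_sigmoid _
  have hp0 : ∀ t ω, 0 < p t ω := fun t ω => hpx t ω ▸ Real.sigmoid_pos _
  have hp1 : ∀ t ω, p t ω < 1 := fun t ω => hpx t ω ▸ Real.sigmoid_lt_one _
  set lam := κ / (2 * η) with hlam
  have hlam0 : 0 < lam := by positivity
  -- Subtracting `x 0 ω` gives `Y 0 = 1`, hence integrability whatever the law of the initial
  -- parameters.
  set Y : ℕ → Ω → ℝ := fun t ω => Real.exp (-lam * (x t ω - x 0 ω)) with hY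
  -- `c t a` is the slope in the reward of the exponent of `Y` when arm `a` is drawn.
  set c : ℕ → Fin 2 → Ω → ℝ := fun t a ω =>
    if a = 0 then -κ * (1 - p t ω) else κ * p t ω with hc
  have hcκ : ∀ t a ω, |c t a ω| ≤ κ := by
    intro t a ω
    have h0 := hp0 t ω
    have h1 := hp1 t ω
    by_cases ha : a = 0
    · simp only [hc, ha, if_true]; rw [abs_le]; constructor <;> nlinarith
    · simp only [hc, ha, if_false]; rw [abs_le]; constructor <;> nlinarith
  have hYsucc : ∀ t ω, Y (t + 1) ω = Y t ω * Real.exp (c t (act t ω) ω * rew t ω) := by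
    intro t ω
    have h := gradientBanditParam_succ_zero_sub_one η (θ₁ ω) (act · ω) (rew · ω) t
    simp only [hY, ← Real.exp_add, hc, hx, h, hp]
    congr 1
    by_cases ha : act t ω = 0 <;> simp only [ha, if_true, if_false, hlam] <;> field_simp <;> ring
  have hxm : ∀ t, Measurable[banditHistory θ₁ act rew t] (x t) := fun t =>
    ((measurable_pi_apply 0).comp (measurable_gradientBanditParam θ₁ act rew η t)).sub
      ((measurable_pi_apply 1).comp (measurable_gradientBanditParam θ₁ act rew η t))
  have hpm : ∀ t, Measurable[banditHistory θ₁ act rew t] (p t) := fun t =>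
    (measurable_softmaxPolicy 0).comp (measurable_gradientBanditParam θ₁ act rew η t)
  have hYm : ∀ t, Measurable[banditHistory θ₁ act rew t] (Y t) := fun t =>
    Real.measurable_exp.comp (((hxm t).sub
      ((hxm 0).mono (banditHistory_mono θ₁ act rew t.zero_le) le_rfl)).const_mul _)
  have hcm : ∀ t a, Measurable[banditHistory θ₁ act rew t] (c t a) := by
    intro t a
    by_cases ha : a = 0
    · simp only [hc, ha, if_true]
      exact (measurable_const.sub (hpm t)).const_mul _
    · simp only [hc, ha, if_false]
      exact (hpm t).const_mul _
  have hY0 : ∀ t ω, 0 < Y t ω := fun t ω => Real.exp_pos _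
  have hexp : ∀ᵐ ω ∂P, ∀ t, |c t (act t ω) ω * rew t ω| ≤ 1 := by
    filter_upwards [hrun.ae_abs_rew_le] with ω hω t
    rw [abs_mul]
    exact (mul_le_mul (hcκ t _ ω) (hω t) (abs_nonneg _) hκ.le).trans hκ1
  have hYb : ∀ᵐ ω ∂P, ∀ t : ℕ, Y t ω ≤ Real.exp t := by
    filter_upwards [hexp] with ω hω t
    induction t with
    | zero => simp [hY]
    | succ t ih =>
      rw [hYsucc, Nat.cast_succ, Real.exp_add]
      exact mul_le_mul ih (Real.exp_le_exp.2 (abs_le.1 (hω t)).2) (Real.exp_pos _).le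
        (Real.exp_pos _).le
  have hYint : ∀ t, Integrable (Y t) P := fun t =>
    Integrable.of_bound (C := Real.exp t)
      ((hYm t).mono (hrun.banditHistory_le t) le_rfl).aestronglyMeasurable
      (hYb.mono fun ω h => by rw [Real.norm_of_nonneg (hY0 t ω).le]; exact h t)
  set D : ℕ → Ω → ℝ := fun t ω => κ * δ / 2 * (p t ω * (1 - p t ω)) * Y t ω with hD
  have hD0 : ∀ t ω, 0 ≤ D t ω := fun t ω => by
    have := hp0 t ω
    have := sub_pos.2 (hp1 t ω)
    have := hY0 t ω
    simp only [hD]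
    positivity
  have hDint : ∀ t, Integrable (D t) P := fun t => by
    refine (hYint t).bdd_mul (c := κ * δ / 2) ?_ (ae_of_all _ fun ω => ?_)
    · exact ((((hpm t).mul (measurable_const.sub (hpm t))).const_mul _).mono
        (hrun.banditHistory_le t) le_rfl).aestronglyMeasurable
    · have h0 := hp0 t ω
      have h1 := hp1 t ω
      have h01 : 0 < p t ω * (1 - p t ω) := mul_pos h0 (sub_pos.2 h1)
      rw [Real.norm_of_nonneg (by positivity)]
      exact mul_le_of_le_one_right (by positivity) (by nlinarith)
  have hstep : ∀ t, P[Y (t + 1) | hrun.filtration t] ≤ᵐ[P] fun ω => Y t ω - D t ω := by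
    intro t
    have hquad : ∀ a ω, 1 + c t a ω ^ 2 * B.Rmax ^ 2 ≤ 1 + κ ^ 2 * B.Rmax ^ 2 := fun a ω => by
      have := sq_le_sq' (abs_le.1 (hcκ t a ω)).1 (abs_le.1 (hcκ t a ω)).2
      gcongr
    have hbound := hrun.condExp_le_of_le_affine_rew t (hYint (t + 1))
      (V := fun a ω => Y t ω * (1 + c t a ω ^ 2 * B.Rmax ^ 2)) (W := fun a ω => Y t ω * c t a ω)
      (C := Real.exp t * (1 + κ ^ 2 * B.Rmax ^ 2 + κ))
      (fun a => (hYm t).mul (measurable_const.add (((hcm t a).pow_const 2).mul_const _)))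
      (fun a => (hYm t).mul (hcm t a))
      (fun a => by
        filter_upwards [hYb] with ω h
        rw [abs_of_nonneg (mul_nonneg (hY0 t ω).le (by positivity))]
        exact mul_le_mul (h t) ((hquad a ω).trans (le_add_of_nonneg_right hκ.le)) (by positivity)
          (Real.exp_pos _).le)
      (fun a => by
        filter_upwards [hYb] with ω h
        rw [abs_mul, abs_of_pos (hY0 t ω)]
        exact mul_le_mul (h t) ((hcκ t a ω).trans (le_add_of_nonneg_left (by positivity)))
          (abs_nonneg _) (Real.exp_pos _).le)
      (by
        filter_upwards [hexp, hrun.ae_abs_rew_le] with ω h hω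
        rw [hYsucc, mul_assoc, ← mul_add]
        refine mul_le_mul_of_nonneg_left ?_ (hY0 t ω).le
        -- For |u| ≤ 1, exp u ≤ 1 + u + u².
        have h1 := (abs_le.1 (Real.abs_exp_sub_one_sub_id_le (h t))).2
        have h2 : (c t (act t ω) ω * rew t ω) ^ 2 ≤ c t (act t ω) ω ^ 2 * B.Rmax ^ 2 := by
          rw [mul_pow]
          exact mul_le_mul_of_nonneg_left (sq_le_sq' (abs_le.1 (hω t)).1 (abs_le.1 (hω t)).2)
            (sq_nonneg _)
        linarith)
    refine hbound.trans (ae_of_all _ fun ω => ?_)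
    have h01 : 0 < p t ω * (1 - p t ω) := mul_pos (hp0 t ω) (sub_pos.2 (hp1 t ω))
    -- Averaging c² over the policy gives κ²(p(1-p)² + (1-p)p²) = κ²p(1-p), so the choice of κ is
    -- used multiplied by κp(1-p)Y.
    have hκv := mul_le_mul_of_nonneg_left hκ2
      (mul_pos (mul_pos hκ h01) (hY0 t ω)).le
    simp only [Fin.sum_univ_two, softmaxPolicy_one_eq, hc, hD, if_true, one_ne_zero, if_false,
      Fin.isValue]
    change p t ω * _ + (1 - p t ω) * _ ≤ _
    rw [hδ] at hκv ⊢
    linear_combination hκv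
  filter_upwards [ae_tendsto_of_condExp_succ_le_sub (ℱ := hrun.filtration)
    (fun t => (hYm t).stronglyMeasurable) hYint (fun t ω => (hY0 t ω).le) hDint hD0 hstep]
    with ω ⟨⟨l, hl⟩, hDlim⟩
  have hxY : ∀ t, x t ω = -Real.log (Y t ω) / lam + x 0 ω := fun t => by
    simp only [hY, Real.log_exp]
    field_simp
    ring
  have hl0 : l = 0 := by
    by_contra hne
    -- For `l ≠ 0` the logarithm is continuous at `l`, so the gap has a finite limit and D a nonzero
    -- one.
    have hxlim : Tendsto (fun t => x t ω) atTop (𝓝 (-Real.log l / lam + x 0 ω)) :=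
      ((((hl.log hne).neg).div_const _).add_const _).congr fun t => (hxY t).symm
    have hplim : Tendsto (fun t => p t ω) atTop
        (𝓝 (Real.sigmoid (-Real.log l / lam + x 0 ω))) := by
      simp only [hpx]
      exact (continuous_sigmoid.tendsto _).comp hxlim
    have h := tendsto_nhds_unique hDlim
      (((hplim.mul (hplim.const_sub 1)).const_mul (κ * δ / 2)).mul hl)
    have h0 := Real.sigmoid_pos (-Real.log l / lam + x 0 ω)
    have h1 := sub_pos.2 (Real.sigmoid_lt_one (-Real.log l / lam + x 0 ω))
    exact mul_ne_zero (by positivity) hne h.symm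
  have hlog : Tendsto (fun t => Real.log (Y t ω)) atTop atBot :=
    Real.tendsto_log_nhdsGT_zero.comp (tendsto_nhdsWithin_iff.2
      ⟨hl0 ▸ hl, Eventually.of_forall fun t => hY0 t ω⟩)
  exact (tendsto_atTop_add_const_right _ _
    ((tendsto_neg_atBot_atTop.comp hlog).atTop_div_const hlam0)).congr fun t => (hxY t).symm

end IsGradientBanditRun

theorem theorem1 {Ω : Type*} [MeasurableSpace Ω] (P : Measure Ω) [IsProbabilityMeasure P]
    (B : StochasticBandit 2) (hB : B.meanReward 1 < B.meanReward 0)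
    (η : ℝ) (hη : 0 < η)
    (θ₁ : Ω → Fin 2 → ℝ) (act : ℕ → Ω → Fin 2) (rew : ℕ → Ω → ℝ)
    (hrun : IsGradientBanditRun P B η θ₁ act rew) :
    ∀ᵐ ω ∂P,
      Tendsto (fun t => softmaxPolicy
        (gradientBanditParam η (θ₁ ω) (act · ω) (rew · ω) t) 0) atTop (𝓝 1) ∧
      Tendsto (fun t => gradientBanditParam η (θ₁ ω) (act · ω) (rew · ω) t 0) atTop atTop ∧
      Tendsto (fun t => gradientBanditParam η (θ₁ ω) (act · ω) (rew · ω) t 1) atTop atBot := by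
  filter_upwards [hrun.ae_tendsto_gap_atTop hη hB] with ω hω
  have hsum := gradientBanditParam_zero_add_one η (θ₁ ω) (act · ω) (rew · ω)
  refine ⟨?_, ?_, ?_⟩
  · simp only [softmaxPolicy_zero_eq_sigmoid]
    exact Real.tendsto_sigmoid_atTop.comp hω
  -- Each parameter is half the conserved sum plus or minus half the gap.
  · refine (tendsto_atTop_add_const_left _ ((θ₁ ω 0 + θ₁ ω 1) / 2)
      (hω.atTop_div_const two_pos)).congr fun t => ?_
    linarith [hsum t]
  · refine (tendsto_atBot_add_const_left _ ((θ₁ ω 0 + θ₁ ω 1) / 2)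
      ((tendsto_neg_atTop_atBot.comp hω).atBot_div_const two_pos)).congr fun t => ?_
    simp only [Function.comp_apply]
    linarith [hsum t]
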